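/- Let $\mathcal D$ be the family of dyadic intervals $[m2^k,(m+1)2^k)$, $k,m\in\mathbb Z$, of the real line. For $I\in\mathcal D$ let $|I|$ be its length, $\mathbf{1}_I$ its indicator function and $\mathbf{h}_I=\mathbf{1}_{I_{\mathrm{left}}}-\mathbf{1}_{I_{\mathrm{right}}}$ its $L^\infty$-normalized Haar function, where $I_{\mathrm{left}}$ and $I_{\mathrm{right}}$ are the left and right halves of $I$. Write $\langle f,g\rangle=\int_{\mathbb R} f(x)g(x)\,dx$. Let $p,q,r$ be real numbers with $$1<p,q,r<\infty,\qquad q>r,\qquad \frac1p+\frac1q+\frac1r=1,$$ and let $\epsilon=(\epsilon_I)_{I\in\mathcal D}$ be real numbers with $|\epsilon_I|\le 1$ for every $I\in\mathcal D$. Then for all real-valued $f\in L^p(\mathbb R)$, $g\in L^q(\mathbb R)$, $h\in L^r(\mathbb R)$ the series $$\Lambda_\epsilon(f,g,h)=\sum_{I\in\mathcal D}\epsilon_I\,|I|^{-2}\,\langle f,\mathbf{1}_I\rangle\,\langle g,\mathbf{h}_I\rangle\,\langle h,\mathbf{h}_I\rangle$$ converges absolutely and $$|\Lambda_\epsilon(f,g,h)|\le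 \mathcal C_{p,q,r}\,\|f\|_{L^p(\mathbb R)}\|g\|_{L^q(\mathbb R)}\|h\|_{L^r(\mathbb R)},\qquad \mathcal C_{p,q,r}=\frac{88\,p\,q^4\,r}{(p-1)(r-1)(q-r)}.$$ -/

import Mathlib

open MeasureTheory

/-- A dyadic interval of the real line, recorded by its scale `k` and position `m`; it stands for
the half-open interval `[m 2^k, (m+1) 2^k)`, see `DyadicInterval.toSet`. -/
@[ext]
structure DyadicInterval where
  scale : ℤ
  pos : ℤ

namespace DyadicInterval

/-- The interval `[m 2^k, (m+1) 2^k)` as a set of reals. -/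
def toSet (I : DyadicInterval) : Set ℝ :=
  Set.Ico ((I.pos : ℝ) * (2 : ℝ) ^ I.scale) (((I.pos : ℝ) + 1) * (2 : ℝ) ^ I.scale)

/-- The length `|I| = 2^k`. -/
noncomputable def length (I : DyadicInterval) : ℝ := (2 : ℝ) ^ I.scale

/-- The left half of a dyadic interval. -/
def left (I : DyadicInterval) : DyadicInterval := ⟨I.scale - 1, 2 * I.pos⟩

/-- The right half of a dyadic interval. -/
def right (I : DyadicInterval) : DyadicInterval := ⟨I.scale - 1, 2 * I.pos + 1⟩

/-- The indicator function of a dyadic interval. -/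
noncomputable def ind (I : DyadicInterval) : ℝ → ℝ := I.toSet.indicator 1

/-- The Haar function of a dyadic interval, normalized in `L^∞`. -/
noncomputable def haar (I : DyadicInterval) : ℝ → ℝ := fun x => I.left.ind x - I.right.ind x

theorem volume_toSet (I : DyadicInterval) : volume I.toSet = ENNReal.ofReal I.length := by
  unfold toSet length
  rw [Real.volume_Ico]
  congr 1
  ring

theorem toSet_eq_union (I : DyadicInterval) : I.toSet = I.left.toSet ∪ I.right.toSet := by
  have h : (2 : ℝ) ^ I.scale = 2 * (2 : ℝ) ^ (I.scale - 1) := by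
    rw [zpow_sub_one₀ two_ne_zero]; ring
  have hpos : (0 : ℝ) < (2 : ℝ) ^ (I.scale - 1) := by positivity
  ext x
  simp only [toSet, left, right, Set.mem_union, Set.mem_Ico, h]
  push_cast
  constructor
  · rintro ⟨h1, h2⟩
    rcases lt_or_ge x ((2 * (I.pos : ℝ) + 1) * (2 : ℝ) ^ (I.scale - 1)) with hx | hx
    · left; constructor <;> nlinarith
    · right; constructor <;> nlinarith
  · rintro (⟨h1, h2⟩ | ⟨h1, h2⟩) <;> constructor <;> nlinarith

/-- Different indices stand for different intervals. -/
theorem toSet_injective : Function.Injective toSet := by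
  intro I J h
  have hl : I.scale = J.scale := by
    have h1 : volume I.toSet = volume J.toSet := by rw [h]
    rw [volume_toSet, volume_toSet, ENNReal.ofReal_eq_ofReal_iff (by unfold length; positivity)
      (by unfold length; positivity)] at h1
    exact zpow_right_injective₀ (by norm_num) (by norm_num) h1
  have key : ∀ K : DyadicInterval, (K.pos : ℝ) * (2 : ℝ) ^ K.scale = sInf K.toSet := by
    intro K
    have hK : (0 : ℝ) < (2 : ℝ) ^ K.scale := by positivity
    exact (csInf_Ico (by nlinarith)).symm
  have h2 : (I.pos : ℝ) * (2 : ℝ) ^ I.scale = (J.pos : ℝ) * (2 : ℝ) ^ J.scale := by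
    rw [key, key, h]
  rw [hl] at h2
  have h3 : (I.pos : ℝ) = J.pos := mul_right_cancel₀ (by positivity) h2
  exact DyadicInterval.ext hl (by exact_mod_cast h3)

end DyadicInterval

/-- The pairing `⟨f, g⟩ = ∫ f g` with respect to Lebesgue measure on the real line. -/
noncomputable def pairing (f g : ℝ → ℝ) : ℝ := ∫ x, f x * g x

/-- The term of the dyadic paraproduct form that belongs to the dyadic interval `I`:
`ε_I |I|^{-2} ⟨f, 1_I⟩ ⟨g, h_I⟩ ⟨h, h_I⟩`. -/
noncomputable def paraproductTerm (ε : DyadicInterval → ℝ) (f g h : ℝ → ℝ)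
    (I : DyadicInterval) : ℝ :=
  ε I * (I.length ^ 2)⁻¹ * pairing f I.ind * pairing g I.haar * pairing h I.haar

/-- The dyadic paraproduct as a trilinear form: the sum over all dyadic intervals. -/
noncomputable def paraproductForm (ε : DyadicInterval → ℝ) (f g h : ℝ → ℝ) : ℝ :=
  ∑' I : DyadicInterval, paraproductTerm ε f g h I

/-! Bellman function argument. Attach to each dyadic interval the means of |f|, |g|, |h|, g and h,
together with running maxima U, V, W of the first three along the chain of ancestors. `bellmanFn` is
a function of these data with three properties. Its mean over the two children exceeds its value at
the parent by at least the paraproduct term per unit length (`bellmanFn_step`). It is nonnegative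
where the maxima start (`bellmanFn_self_nonneg`). It is at most 3p'q'r' times the Young sum of the
p-th, q-th and r-th powers of the means (`bellmanFn_le`), where p', q', r' are the conjugate
exponents. Telescoping down a tree, with Jensen at the bottom, bounds the sum over that tree by
3p'q'r' for normalized functions.

The function has two parts. The quadratic part gains the squared Haar jumps of g and h; alone, it is
bounded only by 3UVW. Subtracting the functions that prove Doob's inequality trades the maxima for
the means.

Two trees meeting at the origin capture any finite family of intervals. This gives 6p'q'r', which is
below the stated constant. -/

/-! ### The Bellman function and its one-step inequality. -/

/-- The quadratic part of the Bellman function. -/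
noncomputable def quadFn (v V : ℝ) : ℝ := v ^ 2 / V + 2 * V

theorem quadFn_nonneg {v V : ℝ} (hV : 0 ≤ V) : 0 ≤ quadFn v V := by
  unfold quadFn; positivity

theorem quadFn_le {v V : ℝ} (hv : |v| ≤ V) : quadFn v V ≤ 3 * V := by
  unfold quadFn
  have hV : 0 ≤ V := (abs_nonneg v).trans hv
  have h : v ^ 2 / V ≤ V := by
    refine div_le_of_le_mul₀ hV hV ?_
    rw [← sq_abs v]
    nlinarith [abs_nonneg v]
  linarith

/-- The coefficient 2 in `quadFn` serves this bound: raising V to b gains 2(b - V) and loses at most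
(b/V)(b - V). The condition b ≤ 2V is dyadic doubling: a child's mean of a nonnegative function is
at most twice its parent's. -/
theorem quadFn_le_quadFn_max {v b V : ℝ} (hv : |v| ≤ b) (hV : 0 ≤ V) (hb : b ≤ 2 * V) :
    quadFn v V ≤ quadFn v (max V b) := by
  rcases le_total b V with h | h
  · rw [max_eq_left h]
  rw [max_eq_right h]
  rcases hV.eq_or_lt with rfl | hV
  · rw [show b = 0 by linarith]
  unfold quadFn
  have hb0 : 0 < b := hV.trans_le h
  have hv2 : v ^ 2 ≤ b ^ 2 := sq_le_sq' (neg_le_of_abs_le hv) (le_of_abs_le hv)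
  have h1 : v ^ 2 / V - v ^ 2 / b = v ^ 2 * ((b - V) / (V * b)) := by field_simp
  have h2 : v ^ 2 * ((b - V) / (V * b)) ≤ b ^ 2 * ((b - V) / (V * b)) :=
    mul_le_mul_of_nonneg_right hv2 (div_nonneg (by linarith) (by positivity))
  have h3 : b ^ 2 * ((b - V) / (V * b)) = b / V * (b - V) := by field_simp
  have h4 : b / V * (b - V) ≤ 2 * (b - V) :=
    mul_le_mul_of_nonneg_right ((div_le_iff₀ hV).2 hb) (by linarith)
  linarith

/-- Running maxima increase the quadratic part, and its mean over the two children exceeds the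
value at the parent by the weighted square of the jump. -/
theorem quadFn_step {v₁ v₂ b₁ b₂ V P P₁ P₂ : ℝ} (hv₁ : |v₁| ≤ b₁) (hv₂ : |v₂| ≤ b₂)
    (hV : (b₁ + b₂) / 2 ≤ V) (hP : 0 ≤ P) (hP₁ : P ≤ P₁) (hP₂ : P ≤ P₂) :
    P * quadFn ((v₁ + v₂) / 2) V + P * (((v₁ - v₂) / 2) ^ 2 / V) ≤
      (P₁ * quadFn v₁ (max V b₁) + P₂ * quadFn v₂ (max V b₂)) / 2 := by
  have hb₁ : 0 ≤ b₁ := (abs_nonneg _).trans hv₁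
  have hb₂ : 0 ≤ b₂ := (abs_nonneg _).trans hv₂
  have hV0 : 0 ≤ V := by linarith
  have h₁ := mul_le_mul hP₁ (quadFn_le_quadFn_max hv₁ hV0 (by linarith)) (quadFn_nonneg hV0)
    (hP.trans hP₁)
  have h₂ := mul_le_mul hP₂ (quadFn_le_quadFn_max hv₂ hV0 (by linarith)) (quadFn_nonneg hV0)
    (hP.trans hP₂)
  have h₃ : P * quadFn ((v₁ + v₂) / 2) V + P * (((v₁ - v₂) / 2) ^ 2 / V) =
      (P * quadFn v₁ V + P * quadFn v₂ V) / 2 := by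
    unfold quadFn; ring
  linarith

/-- The Bellman function of Doob's maximal inequality in `L^p`. -/
noncomputable def doobFn (p u U : ℝ) : ℝ :=
  p * (p / (p - 1)) ^ (-p) * (U ^ p - p / (p - 1) * U ^ (p - 1) * u)

theorem young_rpow_sub_one {p x y : ℝ} (hp : 1 < p) (hx : 0 ≤ x) (hy : 0 ≤ y) :
    x ^ (p - 1) * y ≤ (p - 1) / p * x ^ p + y ^ p / p := by
  have hpq : (p / (p - 1)).HolderConjugate p := (Real.HolderConjugate.conjExponent hp).symm
  have h := Real.young_inequality_of_nonneg (Real.rpow_nonneg hx (p - 1)) hy hpq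
  rw [← Real.rpow_mul hx, mul_div_cancel₀ _ (by linarith : p - 1 ≠ 0)] at h
  refine h.trans_eq ?_
  have : p - 1 ≠ 0 := by linarith
  field_simp

/-- As a function of U, `doobFn` has derivative of the sign of U - u, so it decreases up to U = u.
Young's inequality replaces the derivative. -/
theorem doobFn_max_le {p u U : ℝ} (hp : 1 < p) (hu : 0 ≤ u) (hU : 0 ≤ U) :
    doobFn p u (max U u) ≤ doobFn p u U := by
  rcases le_total u U with h | h
  · rw [max_eq_left h]
  rw [max_eq_right h]
  have hp1 : 0 < p - 1 := by linarith
  unfold doobFn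
  refine mul_le_mul_of_nonneg_left ?_ (by positivity)
  have h1 := young_rpow_sub_one hp hU hu
  have h2 : u ^ p = u ^ (p - 1) * u := by
    rcases hu.eq_or_lt with rfl | hu
    · rw [mul_zero, Real.zero_rpow (by linarith)]
    · rw [← Real.rpow_add_one hu.ne', sub_add_cancel]
  have h3 : p / (p - 1) * U ^ (p - 1) * u ≤ U ^ p + u ^ p / (p - 1) := by
    have := mul_le_mul_of_nonneg_left h1 (by positivity : 0 ≤ p / (p - 1))
    calc _ = p / (p - 1) * (U ^ (p - 1) * u) := by ring
      _ ≤ _ := this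
      _ = _ := by field_simp
  rw [mul_assoc, ← h2]
  have h4 : p / (p - 1) * u ^ p = u ^ p + u ^ p / (p - 1) := by field_simp; ring
  linarith

theorem doobFn_step {p u₁ u₂ U : ℝ} (hp : 1 < p) (hu₁ : 0 ≤ u₁) (hu₂ : 0 ≤ u₂) (hU : 0 ≤ U) :
    (doobFn p u₁ (max U u₁) + doobFn p u₂ (max U u₂)) / 2 ≤ doobFn p ((u₁ + u₂) / 2) U := by
  have h₁ := doobFn_max_le hp hu₁ hU
  have h₂ := doobFn_max_le hp hu₂ hU
  have h₃ : doobFn p ((u₁ + u₂) / 2) U = (doobFn p u₁ U + doobFn p u₂ U) / 2 := by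
    unfold doobFn; ring
  linarith

theorem doobFn_self_nonpos {p u : ℝ} (hp : 1 < p) (hu : 0 ≤ u) : doobFn p u u ≤ 0 := by
  -- The running maximum starts from 0, where `doobFn` vanishes.
  have h := doobFn_max_le hp hu le_rfl
  rw [max_eq_right hu] at h
  refine h.trans_eq ?_
  unfold doobFn
  rw [Real.zero_rpow (by linarith), Real.zero_rpow (by linarith)]
  ring

/-- Young's inequality for U^(p-1) and su, s = p/(p-1): the factor s makes exactly one copy of U^p
survive. -/
theorem div_rpow_le_add_doobFn {p u U : ℝ} (hp : 1 < p) (hu : 0 ≤ u) (hU : 0 ≤ U) :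
    (U / (p / (p - 1))) ^ p ≤ u ^ p + doobFn p u U := by
  have hp1 : 0 < p - 1 := by linarith
  have hp0 : 0 < p := by linarith
  set s := p / (p - 1) with hs
  have hs0 : 0 < s := by positivity
  have h := young_rpow_sub_one hp hU (by positivity : 0 ≤ s * u)
  rw [Real.mul_rpow hs0.le hu] at h
  have hsp : s ^ (-p) * s ^ p = 1 := by
    rw [← Real.rpow_add hs0, neg_add_cancel, Real.rpow_zero]
  have h1 : U ^ p ≤ p * (U ^ p - s * U ^ (p - 1) * u) + s ^ p * u ^ p := by
    have h2 := mul_le_mul_of_nonneg_left h hp0.le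
    have h3 : p * ((p - 1) / p * U ^ p + s ^ p * u ^ p / p) = (p - 1) * U ^ p + s ^ p * u ^ p := by
      field_simp
    rw [h3] at h2
    linarith
  have h2 := mul_le_mul_of_nonneg_left h1 (Real.rpow_nonneg hs0.le (-p))
  rw [Real.div_rpow hU hs0.le, div_eq_inv_mul, ← Real.rpow_neg hs0.le]
  refine h2.trans_eq ?_
  unfold doobFn
  rw [← hs, mul_add, ← mul_assoc _ (s ^ p), hsp]
  ring

theorem mul_mul_le_add_rpow_div {p q r x y z : ℝ} (hp : 1 < p) (hq : 1 < q) (hr : 1 < r)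
    (hpqr : 1 / p + 1 / q + 1 / r = 1) (hx : 0 ≤ x) (hy : 0 ≤ y) (hz : 0 ≤ z) :
    x * y * z ≤ x ^ p / p + y ^ q / q + z ^ r / r := by
  have key : ∀ {s t : ℝ}, 1 < s → 0 ≤ t → (t ^ s) ^ (1 / s) = t := fun {s t} hs ht => by
    rw [← Real.rpow_mul ht, mul_one_div_cancel (by linarith), Real.rpow_one]
  have h := Real.geom_mean_le_arith_mean3_weighted (w₁ := 1 / p) (w₂ := 1 / q) (w₃ := 1 / r)
    (by positivity) (by positivity) (by positivity) (Real.rpow_nonneg hx p)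
    (Real.rpow_nonneg hy q) (Real.rpow_nonneg hz r) hpqr
  rw [key hp hx, key hq hy, key hr hz] at h
  refine h.trans_eq ?_
  ring

/-- The product of the three conjugate exponents. -/
noncomputable def conjProd (p q r : ℝ) : ℝ := p / (p - 1) * (q / (q - 1)) * (r / (r - 1))

theorem conjProd_nonneg {p q r : ℝ} (hp : 1 < p) (hq : 1 < q) (hr : 1 < r) :
    0 ≤ conjProd p q r := by
  have := sub_pos.2 hp
  have := sub_pos.2 hq
  have := sub_pos.2 hr
  unfold conjProd; positivity

/-- The Bellman function of the paraproduct: `u`, `b`, `c` are the means of `|f|`, `|g|`, `|h|`,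
`v` and `w` those of `g` and `h`, and `U`, `V`, `W` are running maxima of `u`, `b`, `c`. -/
noncomputable def bellmanFn (p q r u v w b c U V W : ℝ) : ℝ :=
  (U * W * quadFn v V + U * V * quadFn w W) / 2 -
    3 * conjProd p q r * (doobFn p u U / p + doobFn q b V / q + doobFn r c W / r)

theorem bellmanFn_self_nonneg {p q r u v w b c : ℝ} (hp : 1 < p) (hq : 1 < q) (hr : 1 < r)
    (hu : 0 ≤ u) (hb : 0 ≤ b) (hc : 0 ≤ c) : 0 ≤ bellmanFn p q r u v w b c u b c := by
  have h1 : doobFn p u u / p ≤ 0 := div_nonpos_of_nonpos_of_nonneg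
    (doobFn_self_nonpos hp hu) (by linarith)
  have h2 : doobFn q b b / q ≤ 0 := div_nonpos_of_nonpos_of_nonneg
    (doobFn_self_nonpos hq hb) (by linarith)
  have h3 : doobFn r c c / r ≤ 0 := div_nonpos_of_nonpos_of_nonneg
    (doobFn_self_nonpos hr hc) (by linarith)
  have h4 := mul_nonneg (mul_nonneg hu hc) (quadFn_nonneg (v := v) hb)
  have h5 := mul_nonneg (mul_nonneg hu hb) (quadFn_nonneg (v := w) hc)
  have h6 := mul_nonpos_of_nonneg_of_nonpos
    (mul_nonneg zero_le_three (conjProd_nonneg hp hq hr)) (add_nonpos (add_nonpos h1 h2) h3)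
  unfold bellmanFn
  linarith

theorem bellmanFn_le {p q r u v w b c U V W : ℝ} (hp : 1 < p) (hq : 1 < q) (hr : 1 < r)
    (hpqr : 1 / p + 1 / q + 1 / r = 1) (hu : 0 ≤ u) (hv : |v| ≤ b) (hw : |w| ≤ c)
    (hU : u ≤ U) (hV : b ≤ V) (hW : c ≤ W) :
    bellmanFn p q r u v w b c U V W ≤
      3 * conjProd p q r * (u ^ p / p + b ^ q / q + c ^ r / r) := by
  have hb : 0 ≤ b := (abs_nonneg v).trans hv
  have hc : 0 ≤ c := (abs_nonneg w).trans hw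
  have hU0 := hu.trans hU
  have hV0 := hb.trans hV
  have hW0 := hc.trans hW
  have hp1 := sub_pos.2 hp
  have hq1 := sub_pos.2 hq
  have hr1 := sub_pos.2 hr
  have h1 := mul_le_mul_of_nonneg_left (quadFn_le (hv.trans hV)) (mul_nonneg hU0 hW0)
  have h2 := mul_le_mul_of_nonneg_left (quadFn_le (hw.trans hW)) (mul_nonneg hU0 hV0)
  have h3 := mul_mul_le_add_rpow_div hp hq hr hpqr (x := U / (p / (p - 1)))
    (y := V / (q / (q - 1))) (z := W / (r / (r - 1))) (by positivity) (by positivity)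
    (by positivity)
  have hp2 := div_le_div_of_nonneg_right (div_rpow_le_add_doobFn hp hu hU0)
    (by linarith : 0 ≤ p)
  have hq2 := div_le_div_of_nonneg_right (div_rpow_le_add_doobFn hq hb hV0)
    (by linarith : 0 ≤ q)
  have hr2 := div_le_div_of_nonneg_right (div_rpow_le_add_doobFn hr hc hW0)
    (by linarith : 0 ≤ r)
  -- Dividing each maximum by its Doob constant before Young's inequality produces the factor
  -- `conjProd`.
  have hK : U * V * W = conjProd p q r *
      (U / (p / (p - 1)) * (V / (q / (q - 1))) * (W / (r / (r - 1)))) := by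
    unfold conjProd; field_simp
  have h4 := mul_le_mul_of_nonneg_left (h3.trans (add_le_add (add_le_add hp2 hq2) hr2))
    (conjProd_nonneg hp hq hr)
  rw [← hK, add_div, add_div, add_div] at h4
  unfold bellmanFn
  linarith

/-- The difference of the two sides is UVW(|x|/V - |y|/W)². If V or W is 0, so is the corresponding
jump. -/
theorem two_mul_abs_mul_abs_le {x y V W U : ℝ} (hU : 0 ≤ U) (hx : |x| ≤ V) (hy : |y| ≤ W) :
    2 * (U * |x| * |y|) ≤ U * W * (x ^ 2 / V) + U * V * (y ^ 2 / W) := by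
  have hV := (abs_nonneg x).trans hx
  have hW := (abs_nonneg y).trans hy
  rcases hV.eq_or_lt with rfl | hV
  · rw [le_antisymm hx (abs_nonneg x)]; simp
  rcases hW.eq_or_lt with rfl | hW
  · rw [le_antisymm hy (abs_nonneg y)]; simp
  rw [← sq_abs x, ← sq_abs y]
  have h : U * W * (|x| ^ 2 / V) + U * V * (|y| ^ 2 / W) - 2 * (U * |x| * |y|) =
      U * V * W * (|x| / V - |y| / W) ^ 2 := by field_simp; ring
  have : 0 ≤ U * V * W * (|x| / V - |y| / W) ^ 2 := by positivity
  linarith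

theorem bellmanFn_step {p q r u₁ u₂ v₁ v₂ w₁ w₂ b₁ b₂ c₁ c₂ U V W : ℝ}
    (hp : 1 < p) (hq : 1 < q) (hr : 1 < r) (hu₁ : 0 ≤ u₁) (hu₂ : 0 ≤ u₂)
    (hv₁ : |v₁| ≤ b₁) (hv₂ : |v₂| ≤ b₂) (hw₁ : |w₁| ≤ c₁) (hw₂ : |w₂| ≤ c₂)
    (hU : (u₁ + u₂) / 2 ≤ U) (hV : (b₁ + b₂) / 2 ≤ V) (hW : (c₁ + c₂) / 2 ≤ W) :
    (u₁ + u₂) / 2 * |(v₁ - v₂) / 2| * |(w₁ - w₂) / 2| +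
      bellmanFn p q r ((u₁ + u₂) / 2) ((v₁ + v₂) / 2) ((w₁ + w₂) / 2) ((b₁ + b₂) / 2)
        ((c₁ + c₂) / 2) U V W ≤
      (bellmanFn p q r u₁ v₁ w₁ b₁ c₁ (max U u₁) (max V b₁) (max W c₁) +
        bellmanFn p q r u₂ v₂ w₂ b₂ c₂ (max U u₂) (max V b₂) (max W c₂)) / 2 := by
  have hb₁ : 0 ≤ b₁ := (abs_nonneg _).trans hv₁
  have hb₂ : 0 ≤ b₂ := (abs_nonneg _).trans hv₂
  have hc₁ : 0 ≤ c₁ := (abs_nonneg _).trans hw₁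
  have hc₂ : 0 ≤ c₂ := (abs_nonneg _).trans hw₂
  have hU0 : 0 ≤ U := by linarith
  have hV0 : 0 ≤ V := by linarith
  have hW0 : 0 ≤ W := by linarith
  have mono : ∀ {X Y x y : ℝ}, 0 ≤ X → 0 ≤ Y → X * Y ≤ max X x * max Y y :=
    fun {X Y x y} hX hY => mul_le_mul (le_max_left _ _) (le_max_left _ _) hY
      (hX.trans (le_max_left _ _))
  have h1 := quadFn_step hv₁ hv₂ hV (mul_nonneg hU0 hW0) (mono (x := u₁) (y := c₁) hU0 hW0)
    (mono (x := u₂) (y := c₂) hU0 hW0)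
  have h2 := quadFn_step hw₁ hw₂ hW (mul_nonneg hU0 hV0) (mono (x := u₁) (y := b₁) hU0 hV0)
    (mono (x := u₂) (y := b₂) hU0 hV0)
  have jump : ∀ {x y s t X : ℝ}, |x| ≤ s → |y| ≤ t → (s + t) / 2 ≤ X → |(x - y) / 2| ≤ X :=
    fun {x y s t X} hx hy hX => by
      rw [abs_div, abs_two]
      have := abs_sub x y
      linarith
  have h3 := two_mul_abs_mul_abs_le hU0 (jump hv₁ hv₂ hV) (jump hw₁ hw₂ hW)
  have h4 : (u₁ + u₂) / 2 * |(v₁ - v₂) / 2| * |(w₁ - w₂) / 2| ≤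
      U * |(v₁ - v₂) / 2| * |(w₁ - w₂) / 2| := by gcongr
  have hdp := div_le_div_of_nonneg_right (doobFn_step hp hu₁ hu₂ hU0) (by linarith : 0 ≤ p)
  have hdq := div_le_div_of_nonneg_right (doobFn_step hq hb₁ hb₂ hV0) (by linarith : 0 ≤ q)
  have hdr := div_le_div_of_nonneg_right (doobFn_step hr hc₁ hc₂ hW0) (by linarith : 0 ≤ r)
  have h5 := mul_le_mul_of_nonneg_left (add_le_add (add_le_add hdp hdq) hdr)
    (mul_nonneg zero_le_three (conjProd_nonneg hp hq hr))
  have h6 : ∀ x y s : ℝ, (x + y) / 2 / s = (x / s + y / s) / 2 := fun x y s => by ring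
  rw [h6, h6, h6] at h5
  unfold bellmanFn
  linarith

/-! ### Dyadic means and the tree of descendants. -/

namespace DyadicInterval

theorem length_pos (I : DyadicInterval) : 0 < I.length := by unfold length; positivity

theorem length_left (I : DyadicInterval) : I.left.length = I.length / 2 := by
  unfold length left; rw [zpow_sub_one₀ two_ne_zero]; ring

theorem length_right (I : DyadicInterval) : I.right.length = I.length / 2 := by
  unfold length right; rw [zpow_sub_one₀ two_ne_zero]; ring

theorem measurableSet_toSet (I : DyadicInterval) : MeasurableSet I.toSet := measurableSet_Ico

theorem disjoint_left_right (I : DyadicInterval) : Disjoint I.left.toSet I.right.toSet := by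
  rw [Set.disjoint_left]
  rintro x ⟨-, h1⟩ ⟨h2, -⟩
  simp only [left, right] at h1 h2
  push_cast at h1 h2
  linarith

/-- The mean of a function over a dyadic interval. -/
noncomputable def mean (f : ℝ → ℝ) (I : DyadicInterval) : ℝ :=
  (∫ x in I.toSet, f x) / I.length

theorem length_mul_mean (f : ℝ → ℝ) (I : DyadicInterval) :
    I.length * I.mean f = ∫ x in I.toSet, f x := by
  unfold mean; rw [mul_div_cancel₀ _ I.length_pos.ne']

theorem mean_eq_half_add {f : ℝ → ℝ} (hf : LocallyIntegrable f) (I : DyadicInterval) :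
    I.mean f = (I.left.mean f + I.right.mean f) / 2 := by
  have hint : ∀ J : DyadicInterval, IntegrableOn f J.toSet := fun J =>
    (hf.integrableOn_isCompact isCompact_Icc).mono_set Set.Ico_subset_Icc_self
  unfold mean
  rw [toSet_eq_union, setIntegral_union I.disjoint_left_right I.right.measurableSet_toSet
    (hint _) (hint _), length_left, length_right]
  have := I.length_pos
  field_simp

theorem mean_abs_nonneg (f : ℝ → ℝ) (I : DyadicInterval) : 0 ≤ I.mean (fun x => |f x|) :=
  div_nonneg (integral_nonneg fun _ => abs_nonneg _) I.length_pos.le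

theorem abs_mean_le (f : ℝ → ℝ) (I : DyadicInterval) : |I.mean f| ≤ I.mean (fun x => |f x|) := by
  unfold mean
  rw [abs_div, abs_of_pos I.length_pos]
  exact div_le_div_of_nonneg_right abs_integral_le_integral_abs I.length_pos.le

theorem mean_eq_average (f : ℝ → ℝ) (I : DyadicInterval) :
    I.mean f = ⨍ x in I.toSet, f x := by
  rw [setAverage_eq, measureReal_def, volume_toSet, ENNReal.toReal_ofReal I.length_pos.le,
    smul_eq_mul]
  unfold mean
  ring

theorem mean_abs_rpow_le {p : ℝ} (hp : 1 ≤ p) {f : ℝ → ℝ} (hf : LocallyIntegrable f)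
    (hfp : Integrable fun x => |f x| ^ p) (I : DyadicInterval) :
    I.mean (fun x => |f x|) ^ p ≤ I.mean (fun x => |f x| ^ p) := by
  have hint : IntegrableOn f I.toSet :=
    (hf.integrableOn_isCompact isCompact_Icc).mono_set Set.Ico_subset_Icc_self
  rw [mean_eq_average, mean_eq_average]
  refine (convexOn_rpow hp).map_set_average_le ?_ isClosed_Ici ?_ ?_ ?_ hint.abs
    hfp.integrableOn
  · exact (Real.continuous_rpow_const (by linarith)).continuousOn
  · rw [volume_toSet]; simpa using I.length_pos
  · rw [volume_toSet]; exact ENNReal.ofReal_ne_top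
  · exact Filter.Eventually.of_forall fun x => abs_nonneg (f x)

/-- The dyadic interval of twice the length that contains a given one. -/
def parent (I : DyadicInterval) : DyadicInterval := ⟨I.scale + 1, I.pos / 2⟩

theorem eq_left_or_eq_right_parent (I : DyadicInterval) :
    I = I.parent.left ∨ I = I.parent.right := by
  rcases Int.emod_two_eq_zero_or_one I.pos with h | h
  · left; ext <;> simp only [parent, left] <;> omega
  · right; ext <;> simp only [parent, right] <;> omega

theorem iterate_parent (I : DyadicInterval) (j : ℕ) :
    parent^[j] I = ⟨I.scale + j, I.pos / 2 ^ j⟩ := by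
  induction j with
  | zero => simp
  | succ j ih =>
    rw [Function.iterate_succ_apply', ih, parent, pow_succ,
      Int.ediv_ediv_of_nonneg (by positivity)]
    ext <;> simp [add_assoc]

open scoped Classical in
/-- The `n` topmost generations of dyadic subintervals of `I`. -/
noncomputable def descendants : ℕ → DyadicInterval → Finset DyadicInterval
  | 0, _ => ∅
  | n + 1, I => {I} ∪ (descendants n I.left ∪ descendants n I.right)

theorem mem_descendants {j n : ℕ} (hjn : j < n) (I : DyadicInterval) :
    I ∈ descendants n (parent^[j] I) := by
  induction n generalizing j with
  | zero => omega
  | succ n ih =>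
    simp only [descendants, Finset.mem_union, Finset.mem_singleton]
    rcases j with _ | j
    · exact Or.inl rfl
    · right
      have h := ih (j := j) (by omega)
      rw [Function.iterate_succ_apply']
      rcases (parent^[j] I).eq_left_or_eq_right_parent with h' | h' <;> rw [h'] at h
      · exact Or.inl h
      · exact Or.inr h

/-- Nonnegativity of the terms makes disjointness of the subtrees irrelevant. -/
theorem sum_descendants_succ_le {a : DyadicInterval → ℝ} (ha : ∀ I, 0 ≤ a I) (n : ℕ)
    (I : DyadicInterval) : ∑ J ∈ descendants (n + 1) I, a J ≤
      a I + (∑ J ∈ descendants n I.left, a J + ∑ J ∈ descendants n I.right, a J) := by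
  classical
  have key : ∀ s t : Finset DyadicInterval,
      ∑ J ∈ s ∪ t, a J ≤ ∑ J ∈ s, a J + ∑ J ∈ t, a J := fun s t => by
    rw [← Finset.sum_union_inter]
    exact le_add_of_nonneg_right (Finset.sum_nonneg fun J _ => ha J)
  rw [descendants]
  refine (key _ _).trans ?_
  rw [Finset.sum_singleton]
  exact add_le_add_right (key _ _) _

/-- Finitely many dyadic intervals descend from two adjacent ones that meet at the origin. -/
theorem exists_subset_descendants [DecidableEq DyadicInterval] (s : Finset DyadicInterval) :
    ∃ (n : ℕ) (I J : DyadicInterval), s ⊆ descendants n I ∪ descendants n J := by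
  have h : ∀ I ∈ s, ∀ᶠ N : ℕ in Filter.atTop,
      -- The 2N+1 generations have scales from N down to -N. The ancestor at scale N is j steps up
      -- with |pos| ≤ j < 2^j, so its position is 0 or -1.
      I ∈ descendants (2 * N + 1) ⟨N, 0⟩ ∪ descendants (2 * N + 1) ⟨N, -1⟩ := by
    intro I _
    filter_upwards [Filter.eventually_ge_atTop (I.scale.natAbs + I.pos.natAbs)] with N hN
    obtain ⟨j, hj⟩ : ∃ j : ℕ, I.scale + j = N := ⟨(N - I.scale).toNat, by omega⟩
    have hmem := mem_descendants (j := j) (n := 2 * N + 1) (by omega) I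
    rw [iterate_parent, hj] at hmem
    have hpow : (I.pos.natAbs : ℤ) < 2 ^ j := by
      exact_mod_cast (by omega : I.pos.natAbs ≤ j).trans_lt Nat.lt_two_pow_self
    rw [Finset.mem_union]
    rcases le_or_gt 0 I.pos with h0 | h0
    · left
      rwa [Int.ediv_eq_zero_of_lt h0 (by omega)] at hmem
    · right
      have : I.pos / 2 ^ j = -1 := by
        rw [Int.ediv_eq_iff_of_pos (by positivity)]
        constructor <;> linarith [show (I.pos.natAbs : ℤ) = -I.pos by omega]
      rwa [this] at hmem
  obtain ⟨N, hN⟩ := ((Filter.eventually_all_finset s).2 h).exists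
  exact ⟨2 * N + 1, ⟨N, 0⟩, ⟨N, -1⟩, hN⟩

end DyadicInterval

/-! ### Domination of the form and summation over a tree. -/

open DyadicInterval

theorem pairing_ind (f : ℝ → ℝ) (I : DyadicInterval) :
    pairing f I.ind = ∫ x in I.toSet, f x := by
  rw [← integral_indicator I.measurableSet_toSet]
  refine integral_congr_ae (.of_forall fun x => ?_)
  by_cases hx : x ∈ I.toSet <;> simp [ind, hx]

theorem pairing_haar {f : ℝ → ℝ} (hf : LocallyIntegrable f) (I : DyadicInterval) :
    pairing f I.haar = I.length * ((I.left.mean f - I.right.mean f) / 2) := by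
  have hint : ∀ J : DyadicInterval, Integrable fun x => f x * J.ind x := fun J => by
    have h : IntegrableOn f J.toSet :=
      (hf.integrableOn_isCompact isCompact_Icc).mono_set Set.Ico_subset_Icc_self
    refine (h.integrable_indicator J.measurableSet_toSet).congr (.of_forall fun x => ?_)
    by_cases hx : x ∈ J.toSet <;> simp [ind, hx]
  have h : pairing f I.haar = pairing f I.left.ind - pairing f I.right.ind := by
    unfold pairing haar
    rw [← integral_sub (hint _) (hint _)]
    simp only [mul_sub]
  rw [h, pairing_ind, pairing_ind, ← length_mul_mean, ← length_mul_mean, length_left,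
    length_right]
  ring

/-- The nonnegative quantity that dominates a term of the paraproduct form. -/
noncomputable def paraproductBound (f g h : ℝ → ℝ) (I : DyadicInterval) : ℝ :=
  I.length * (I.mean (fun x => |f x|) * |(I.left.mean g - I.right.mean g) / 2| *
    |(I.left.mean h - I.right.mean h) / 2|)

theorem paraproductBound_nonneg (f g h : ℝ → ℝ) (I : DyadicInterval) :
    0 ≤ paraproductBound f g h I := by
  have := I.length_pos
  have := I.mean_abs_nonneg f
  unfold paraproductBound; positivity

theorem abs_paraproductTerm_le {ε : DyadicInterval → ℝ} (hε : ∀ I, |ε I| ≤ 1) {f g h : ℝ → ℝ}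
    (hg : LocallyIntegrable g) (hh : LocallyIntegrable h) (I : DyadicInterval) :
    |paraproductTerm ε f g h I| ≤ paraproductBound f g h I := by
  have hI := I.length_pos
  unfold paraproductTerm paraproductBound
  rw [pairing_ind, pairing_haar hg, pairing_haar hh, ← length_mul_mean]
  set x := (I.left.mean g - I.right.mean g) / 2
  set y := (I.left.mean h - I.right.mean h) / 2
  rw [show ε I * (I.length ^ 2)⁻¹ * (I.length * I.mean f) * (I.length * x) * (I.length * y) =
    ε I * (I.length * (I.mean f * x * y)) by field_simp, abs_mul, abs_mul, abs_mul, abs_mul,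
    abs_of_pos hI]
  refine (mul_le_of_le_one_left (by positivity) (hε I)).trans ?_
  gcongr
  exact I.abs_mean_le f

theorem sum_descendants_paraproductBound_add_le {p q r : ℝ} (hp : 1 < p) (hq : 1 < q)
    (hr : 1 < r) (hpqr : 1 / p + 1 / q + 1 / r = 1) {f g h : ℝ → ℝ}
    (hf : LocallyIntegrable f) (hg : LocallyIntegrable g) (hh : LocallyIntegrable h)
    (hfp : Integrable fun x => |f x| ^ p) (hgq : Integrable fun x => |g x| ^ q)
    (hhr : Integrable fun x => |h x| ^ r) (n : ℕ) (I : DyadicInterval) {U V W : ℝ}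
    (hU : I.mean (fun x => |f x|) ≤ U) (hV : I.mean (fun x => |g x|) ≤ V)
    (hW : I.mean (fun x => |h x|) ≤ W) :
    ∑ J ∈ descendants n I, paraproductBound f g h J +
      I.length * bellmanFn p q r (I.mean fun x => |f x|) (I.mean g) (I.mean h)
        (I.mean fun x => |g x|) (I.mean fun x => |h x|) U V W ≤
      I.length * (3 * conjProd p q r * ((I.mean fun x => |f x| ^ p) / p +
        (I.mean fun x => |g x| ^ q) / q + (I.mean fun x => |h x| ^ r) / r)) := by
  have hI := I.length_pos
  have hfa : LocallyIntegrable fun x => |f x| := fun x => (hf x).norm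
  have hga : LocallyIntegrable fun x => |g x| := fun x => (hg x).norm
  have hha : LocallyIntegrable fun x => |h x| := fun x => (hh x).norm
  induction n generalizing I U V W with
  | zero =>
    rw [descendants, Finset.sum_empty, zero_add]
    refine mul_le_mul_of_nonneg_left ?_ hI.le
    refine (bellmanFn_le hp hq hr hpqr (I.mean_abs_nonneg f) (I.abs_mean_le g)
      (I.abs_mean_le h) hU hV hW).trans ?_
    refine mul_le_mul_of_nonneg_left ?_ (mul_nonneg zero_le_three (conjProd_nonneg hp hq hr))
    gcongr
    · exact mean_abs_rpow_le hp.le hf hfp I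
    · exact mean_abs_rpow_le hq.le hg hgq I
    · exact mean_abs_rpow_le hr.le hh hhr I
  | succ n ih =>
    -- The induction hypothesis holds for arbitrary maxima above the means, so each child can use
    -- its updated ones.
    have hl := ih I.left (U := max U (I.left.mean fun x => |f x|))
      (V := max V (I.left.mean fun x => |g x|)) (W := max W (I.left.mean fun x => |h x|))
      (le_max_right _ _) (le_max_right _ _) (le_max_right _ _) I.left.length_pos
    have hr' := ih I.right (U := max U (I.right.mean fun x => |f x|))
      (V := max V (I.right.mean fun x => |g x|)) (W := max W (I.right.mean fun x => |h x|))
      (le_max_right _ _) (le_max_right _ _) (le_max_right _ _) I.right.length_pos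
    rw [length_left] at hl
    rw [length_right] at hr'
    have hs := sum_descendants_succ_le (paraproductBound_nonneg f g h) n I
    rw [mean_eq_half_add hfa] at hU
    rw [mean_eq_half_add hga] at hV
    rw [mean_eq_half_add hha] at hW
    have hstep := mul_le_mul_of_nonneg_left
      (bellmanFn_step hp hq hr (I.left.mean_abs_nonneg f) (I.right.mean_abs_nonneg f)
        (I.left.abs_mean_le g) (I.right.abs_mean_le g) (I.left.abs_mean_le h)
        (I.right.abs_mean_le h) hU hV hW) hI.le
    rw [mul_add] at hstep
    rw [← mean_eq_half_add hfa, ← mean_eq_half_add hga, ← mean_eq_half_add hha,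
      ← mean_eq_half_add hg, ← mean_eq_half_add hh, ← paraproductBound] at hstep
    rw [mean_eq_half_add hfp.locallyIntegrable, mean_eq_half_add hgq.locallyIntegrable,
      mean_eq_half_add hhr.locallyIntegrable]
    set X := 3 * conjProd p q r
    have hsplit : ∀ a₁ a₂ b₁ b₂ c₁ c₂ : ℝ,
        I.length * (X * ((a₁ + a₂) / 2 / p + (b₁ + b₂) / 2 / q + (c₁ + c₂) / 2 / r)) =
        I.length / 2 * (X * (a₁ / p + b₁ / q + c₁ / r)) +
        I.length / 2 * (X * (a₂ / p + b₂ / q + c₂ / r)) := fun _ _ _ _ _ _ => by ring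
    rw [hsplit]
    linarith

theorem sum_paraproductBound_le_of_integral_le_one {p q r : ℝ} (hp : 1 < p) (hq : 1 < q)
    (hr : 1 < r) (hpqr : 1 / p + 1 / q + 1 / r = 1) {f g h : ℝ → ℝ}
    (hf : LocallyIntegrable f) (hg : LocallyIntegrable g) (hh : LocallyIntegrable h)
    (hfp : Integrable fun x => |f x| ^ p) (hgq : Integrable fun x => |g x| ^ q)
    (hhr : Integrable fun x => |h x| ^ r) (hf1 : ∫ x, |f x| ^ p ≤ 1) (hg1 : ∫ x, |g x| ^ q ≤ 1)
    (hh1 : ∫ x, |h x| ^ r ≤ 1) (s : Finset DyadicInterval) :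
    ∑ I ∈ s, paraproductBound f g h I ≤ 6 * conjProd p q r := by
  classical
  have tree : ∀ n I, ∑ J ∈ descendants n I, paraproductBound f g h J ≤ 3 * conjProd p q r := by
    intro n I
    have h1 := sum_descendants_paraproductBound_add_le hp hq hr hpqr hf hg hh hfp hgq hhr n I
      le_rfl le_rfl le_rfl
    have h2 := mul_nonneg I.length_pos.le (bellmanFn_self_nonneg hp hq hr
      (v := I.mean g) (w := I.mean h)
      (I.mean_abs_nonneg f) (I.mean_abs_nonneg g) (I.mean_abs_nonneg h))
    have key : ∀ {F : ℝ → ℝ} {t : ℝ}, Integrable (fun x => |F x| ^ t) → ∫ x, |F x| ^ t ≤ 1 →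
        I.length * (I.mean fun x => |F x| ^ t) ≤ 1 := fun {F t} hF hF1 => by
      rw [length_mul_mean]
      exact (setIntegral_le_integral hF
        (.of_forall fun x => Real.rpow_nonneg (abs_nonneg _) _)).trans hF1
    refine (le_add_of_nonneg_right h2).trans (h1.trans ?_)
    calc _ = 3 * conjProd p q r * ((I.length * I.mean fun x => |f x| ^ p) / p +
          (I.length * I.mean fun x => |g x| ^ q) / q +
          (I.length * I.mean fun x => |h x| ^ r) / r) := by ring
      _ ≤ 3 * conjProd p q r * (1 / p + 1 / q + 1 / r) := by
        refine mul_le_mul_of_nonneg_left ?_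
          (mul_nonneg zero_le_three (conjProd_nonneg hp hq hr))
        gcongr
        · exact key hfp hf1
        · exact key hgq hg1
        · exact key hhr hh1
      _ = _ := by rw [hpqr, mul_one]
  obtain ⟨n, I, J, hs⟩ := exists_subset_descendants s
  have hsum : ∑ K ∈ s, paraproductBound f g h K ≤ ∑ K ∈ descendants n I,
      paraproductBound f g h K + ∑ K ∈ descendants n J, paraproductBound f g h K := by
    refine (Finset.sum_le_sum_of_subset_of_nonneg hs
      fun K _ _ => paraproductBound_nonneg f g h K).trans ?_
    rw [← Finset.sum_union_inter]
    exact le_add_of_nonneg_right (Finset.sum_nonneg fun K _ => paraproductBound_nonneg f g h K)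
  linarith [tree n I, tree n J]

/-! ### Normalization, the constant and the conclusion. -/

theorem integral_abs_rpow_le_one {p : ℝ} (hp : 1 < p) {f : ℝ → ℝ}
    (hf : MemLp f (ENNReal.ofReal p)) (h1 : (eLpNorm f (ENNReal.ofReal p) volume).toReal ≤ 1) :
    ∫ x, |f x| ^ p ≤ 1 := by
  have hp0 : 0 < p := by linarith
  have hnn : 0 ≤ ∫ x, |f x| ^ p := integral_nonneg fun x => Real.rpow_nonneg (abs_nonneg _) _
  rw [hf.eLpNorm_eq_integral_rpow_norm (by simpa using hp0) ENNReal.ofReal_ne_top,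
    ENNReal.toReal_ofReal hp0.le] at h1
  simp only [Real.norm_eq_abs] at h1
  rw [ENNReal.toReal_ofReal (Real.rpow_nonneg hnn _)] at h1
  by_contra! hlt
  exact absurd (Real.one_lt_rpow hlt (inv_pos.2 hp0)) (not_lt.2 h1)

theorem integrable_abs_rpow {p : ℝ} (hp : 1 < p) {f : ℝ → ℝ}
    (hf : MemLp f (ENNReal.ofReal p)) : Integrable fun x => |f x| ^ p := by
  have h := hf.integrable_norm_rpow (by simpa using by linarith) ENNReal.ofReal_ne_top
  rwa [ENNReal.toReal_ofReal (by linarith)] at h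

theorem toReal_eLpNorm_inv_mul_le_one {p a : ℝ} (ha : 0 < a) {f : ℝ → ℝ}
    (h : (eLpNorm f (ENNReal.ofReal p) volume).toReal ≤ a) :
    (eLpNorm (fun x => a⁻¹ * f x) (ENNReal.ofReal p) volume).toReal ≤ 1 := by
  have : (fun x => a⁻¹ * f x) = a⁻¹ • f := rfl
  rw [this, eLpNorm_const_smul, ENNReal.toReal_mul, toReal_enorm, Real.norm_eq_abs,
    abs_of_pos (inv_pos.2 ha), inv_mul_le_iff₀ ha, mul_one]
  exact h

theorem DyadicInterval.mean_const_mul (a : ℝ) (f : ℝ → ℝ) (I : DyadicInterval) :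
    I.mean (fun x => a * f x) = a * I.mean f := by
  unfold mean; rw [integral_const_mul, mul_div_assoc]

theorem paraproductBound_const_mul {a b c : ℝ} (ha : 0 ≤ a) (hb : 0 ≤ b) (hc : 0 ≤ c)
    (f g h : ℝ → ℝ) (I : DyadicInterval) :
    paraproductBound (fun x => a * f x) (fun x => b * g x) (fun x => c * h x) I =
      a * b * c * paraproductBound f g h I := by
  unfold paraproductBound
  simp only [abs_mul a, mean_const_mul, ← mul_sub, mul_div_assoc, abs_mul b, abs_mul c,
    abs_of_nonneg ha, abs_of_nonneg hb, abs_of_nonneg hc]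
  ring

theorem sum_paraproductBound_le {p q r : ℝ} (hp : 1 < p) (hq : 1 < q)
    (hr : 1 < r) (hpqr : 1 / p + 1 / q + 1 / r = 1) {f g h : ℝ → ℝ}
    (hf : MemLp f (ENNReal.ofReal p)) (hg : MemLp g (ENNReal.ofReal q))
    (hh : MemLp h (ENNReal.ofReal r)) (s : Finset DyadicInterval) :
    ∑ I ∈ s, paraproductBound f g h I ≤ 6 * conjProd p q r *
      (eLpNorm f (ENNReal.ofReal p) volume).toReal *
      (eLpNorm g (ENNReal.ofReal q) volume).toReal *
      (eLpNorm h (ENNReal.ofReal r) volume).toReal := by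
  set A := (eLpNorm f (ENNReal.ofReal p) volume).toReal with hA
  set B := (eLpNorm g (ENNReal.ofReal q) volume).toReal with hB
  set C := (eLpNorm h (ENNReal.ofReal r) volume).toReal with hC
  have hA0 : 0 ≤ A := ENNReal.toReal_nonneg
  have hB0 : 0 ≤ B := ENNReal.toReal_nonneg
  have hC0 : 0 ≤ C := ENNReal.toReal_nonneg
  have loc : ∀ {t : ℝ} {F : ℝ → ℝ}, 1 < t → MemLp F (ENNReal.ofReal t) → LocallyIntegrable F :=
    fun ht hF => hF.locallyIntegrable (by simpa using ht.le)
  -- Normalizing by the norm plus δ, with δ → 0 afterwards, also covers functions of norm 0.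
  have key : ∀ δ : ℝ, 0 < δ → ∑ I ∈ s, paraproductBound f g h I ≤
      6 * conjProd p q r * (A + δ) * (B + δ) * (C + δ) := by
    intro δ hδ
    have ha : 0 < A + δ := by linarith
    have hb : 0 < B + δ := by linarith
    have hc : 0 < C + δ := by linarith
    have hf' : MemLp (fun x => (A + δ)⁻¹ * f x) (ENNReal.ofReal p) := hf.const_mul _
    have hg' : MemLp (fun x => (B + δ)⁻¹ * g x) (ENNReal.ofReal q) := hg.const_mul _
    have hh' : MemLp (fun x => (C + δ)⁻¹ * h x) (ENNReal.ofReal r) := hh.const_mul _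
    have hmain := sum_paraproductBound_le_of_integral_le_one hp hq hr hpqr (loc hp hf')
      (loc hq hg') (loc hr hh') (integrable_abs_rpow hp hf') (integrable_abs_rpow hq hg')
      (integrable_abs_rpow hr hh')
      (integral_abs_rpow_le_one hp hf' (toReal_eLpNorm_inv_mul_le_one ha (by linarith)))
      (integral_abs_rpow_le_one hq hg' (toReal_eLpNorm_inv_mul_le_one hb (by linarith)))
      (integral_abs_rpow_le_one hr hh' (toReal_eLpNorm_inv_mul_le_one hc (by linarith))) s
    simp only [paraproductBound_const_mul (inv_pos.2 ha).le (inv_pos.2 hb).le (inv_pos.2 hc).le]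
      at hmain
    rw [← Finset.mul_sum, ← mul_inv, ← mul_inv, inv_mul_le_iff₀ (by positivity)] at hmain
    refine hmain.trans_eq ?_
    ring
  have hlim : Filter.Tendsto (fun δ : ℝ => 6 * conjProd p q r * (A + δ) * (B + δ) * (C + δ))
      (nhdsWithin 0 (Set.Ioi 0)) (nhds (6 * conjProd p q r * A * B * C)) := by
    have hcont : Continuous fun δ : ℝ => 6 * conjProd p q r * (A + δ) * (B + δ) * (C + δ) := by
      fun_prop
    have := hcont.tendsto 0
    simp only [add_zero] at this
    exact this.mono_left nhdsWithin_le_nhds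
  exact ge_of_tendsto hlim (Filter.eventually_of_mem self_mem_nhdsWithin key)

theorem six_mul_conjProd_le {p q r : ℝ} (hp : 1 < p) (hr : 1 < r) (hrq : r < q) :
    6 * conjProd p q r ≤ 88 * p * q ^ 4 * r / ((p - 1) * (r - 1) * (q - r)) := by
  have hp1 := sub_pos.2 hp
  have hr1 := sub_pos.2 hr
  have hqr := sub_pos.2 hrq
  have hq1 : 0 < q - 1 := by linarith
  -- Here q ≤ q^4, and q - r ≤ q - 1 because r > 1.
  have hq : q / (q - 1) ≤ q ^ 4 / (q - r) :=
    div_le_div₀ (by positivity) (le_self_pow₀ (by linarith) (by norm_num)) hqr (by linarith)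
  have hq0 : 0 ≤ q ^ 4 / (q - r) := by positivity
  calc 6 * conjProd p q r = p / (p - 1) * (r / (r - 1)) * (6 * (q / (q - 1))) := by
        unfold conjProd; ring
    _ ≤ p / (p - 1) * (r / (r - 1)) * (88 * (q ^ 4 / (q - r))) := by
        refine mul_le_mul_of_nonneg_left (by linarith) (by positivity)
    _ = _ := by field_simp

theorem mainTheorem2 (p q r : ℝ) (hp : 1 < p) (hq : 1 < q) (hr : 1 < r) (hrq : r < q)
    (hpqr : 1 / p + 1 / q + 1 / r = 1)
    (ε : DyadicInterval → ℝ) (hε : ∀ I, |ε I| ≤ 1)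
    (f g h : ℝ → ℝ)
    (hf : MemLp f (ENNReal.ofReal p) volume)
    (hg : MemLp g (ENNReal.ofReal q) volume)
    (hh : MemLp h (ENNReal.ofReal r) volume) :
    Summable (paraproductTerm ε f g h) ∧
    |paraproductForm ε f g h| ≤
      88 * p * q ^ 4 * r / ((p - 1) * (r - 1) * (q - r)) *
        (eLpNorm f (ENNReal.ofReal p) volume).toReal *
        (eLpNorm g (ENNReal.ofReal q) volume).toReal *
        (eLpNorm h (ENNReal.ofReal r) volume).toReal := by
  have hgl : LocallyIntegrable g := hg.locallyIntegrable (by simpa using hq.le)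
  have hhl : LocallyIntegrable h := hh.locallyIntegrable (by simpa using hr.le)
  have hterm : ∀ I, ‖paraproductTerm ε f g h I‖ ≤ paraproductBound f g h I :=
    abs_paraproductTerm_le hε hgl hhl
  have hsum := sum_paraproductBound_le hp hq hr hpqr hf hg hh
  have hs : Summable (paraproductBound f g h) :=
    summable_of_sum_le (paraproductBound_nonneg f g h) hsum
  refine ⟨hs.of_norm_bounded hterm, ?_⟩
  rw [← Real.norm_eq_abs]
  refine (tsum_of_norm_bounded hs.hasSum hterm).trans ?_
  refine (hs.tsum_le_of_sum_le hsum).trans ?_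
  gcongr
  exact six_mul_conjProd_le hp hr hrq
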